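/- **Theorem 3.10 (Preservation of goodness in short direct limits).** Fix an increasing sequence $\langle\sqsubset_n\rangle_{n<\omega}$ of closed binary relations on $\omega^\omega$ such that $\{f\in\omega^\omega : f\sqsubset_n g\}$ is nowhere dense for all $n<\omega$ and $g\in\omega^\omega$, and let $\sqsubset\;=\bigcup_{n<\omega}\sqsubset_n$ (in generic extensions, each $\sqsubset_n$ denotes the closed relation with the same code). For $f\in\omega^\omega$ and $Y\subseteq\omega^\omega$ write $f\not\sqsubset Y$ if $f\not\sqsubset g$ for every $g\in Y$. For a cardinal $\theta$, a forcing notion $\mathbb P$ is called *$\theta$-$\sqsubset$-good* if for every $\mathbb P$-name $\dot h$ for a real in $\omega^\omega$ there is a nonempty $Y\subseteq\omega^\omega$ (in the ground model) with $|Y|<\theta$ such that, for every $f\in\omega^\omega$ (in the ground model), if $f\not\sqsubset Y$ then $\Vdash_{\mathbb P} f\not\sqsubset\dot h$. $\mathbb P$ is a *complete suborder* of $\mathbb Q$ if $\mathbb P\subseteq\mathbb Q$ with the inherited order, incompatible conditions of $\mathbb P$ are incompatible in $\mathbb Q$, and every maximal antichain of $\mathbb P$ is a maximal antichain of $\mathbb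 Q$. Let $\theta$ be an uncountable regular cardinal and let $I$ be a directed partial order with $|I|<\theta$. Let $\langle\mathbb P_i\rangle_{i\in I}$ be a directed system of posets, that is, $\mathbb P_i$ is a complete suborder of $\mathbb P_j$ whenever $i<j$ in $I$, and let $\mathbb P=\bigcup_{i\in I}\mathbb P_i$ be its direct limit (ordered by the union of the orders). If $\mathbb P_i$ is $\theta$-$\sqsubset$-good for every $i\in I$, then $\mathbb P$ is $\theta$-$\sqsubset$-good. -/

import Mathlib

universe u v

namespace GoodForcing

/-! ## Forcing notions on a set, complete suborders, direct limits -/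

/-- A forcing notion whose conditions are elements of the ambient type `U`: a set of conditions with
a reflexive and transitive relation; `le p q` says that `p` is stronger than `q`. Antisymmetry is
not required, so partial orders and preorders are both covered. -/
structure Poset (U : Type u) where
  carrier : Set U
  le : U → U → Prop
  refl' : ∀ p ∈ carrier, le p p
  trans' : ∀ p ∈ carrier, ∀ q ∈ carrier, ∀ r ∈ carrier, le p q → le q r → le p r

/-- The type of conditions of a forcing notion. -/
abbrev Poset.Cond {U : Type u} (P : Poset U) : Type u := {p : U // p ∈ P.carrier}

instance {U : Type u} (P : Poset U) : Preorder P.Cond where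
  le p q := P.le p.1 q.1
  le_refl p := P.refl' p.1 p.2
  le_trans p q r h₁ h₂ := P.trans' p.1 p.2 q.1 q.2 r.1 r.2 h₁ h₂

/-- `p` and `q` have a common extension among the conditions of `P`. -/
def Poset.Compatible {U : Type u} (P : Poset U) (p q : U) : Prop :=
  ∃ r ∈ P.carrier, P.le r p ∧ P.le r q

/-- `A` is a maximal antichain of `P`: a set of pairwise incompatible conditions such that every
condition is compatible with a member of it. -/
def Poset.IsMaxAntichain {U : Type u} (P : Poset U) (A : Set U) : Prop :=
  A ⊆ P.carrier ∧
  (∀ p ∈ A, ∀ q ∈ A, p ≠ q → ¬ P.Compatible p q) ∧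
  ∀ p ∈ P.carrier, ∃ a ∈ A, P.Compatible p a

/-- `P` is a complete suborder of `Q`: the conditions of `P` are conditions of `Q` with the order
inherited from `Q`, incompatible conditions of `P` stay incompatible in `Q`, and maximal antichains
of `P` are maximal antichains of `Q`. -/
def Poset.IsCompleteSuborder {U : Type u} (P Q : Poset U) : Prop :=
  P.carrier ⊆ Q.carrier ∧
  (∀ p ∈ P.carrier, ∀ q ∈ P.carrier, (P.le p q ↔ Q.le p q)) ∧
  (∀ p ∈ P.carrier, ∀ q ∈ P.carrier, Q.Compatible p q → P.Compatible p q) ∧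
  ∀ A : Set U, P.IsMaxAntichain A → Q.IsMaxAntichain A

/-- A directed system of forcing notions (along complete suborders). -/
def IsDirectedPosetSystem {U : Type u} {I : Type v} [PartialOrder I] (P : I → Poset U) : Prop :=
  ∀ i j : I, i < j → (P i).IsCompleteSuborder (P j)

theorem IsDirectedPosetSystem.mem_mono {U : Type u} {I : Type v} [PartialOrder I] {P : I → Poset U}
    (hP : IsDirectedPosetSystem P) {i j : I} (hij : i ≤ j) {p : U} (hp : p ∈ (P i).carrier) :
    p ∈ (P j).carrier := by
  rcases hij.eq_or_lt with rfl | h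
  · exact hp
  · exact (hP i j h).1 hp

theorem IsDirectedPosetSystem.le_iff {U : Type u} {I : Type v} [PartialOrder I] {P : I → Poset U}
    (hP : IsDirectedPosetSystem P) {i j : I} (hij : i ≤ j) {p q : U} (hp : p ∈ (P i).carrier)
    (hq : q ∈ (P i).carrier) : (P i).le p q ↔ (P j).le p q := by
  rcases hij.eq_or_lt with rfl | h
  · exact Iff.rfl
  · exact (hP i j h).2.1 p hp q hq

/-- The direct limit of a directed system: the union `⋃ i, P i`, ordered by the union of the
orders. -/
def directLimit {U : Type u} {I : Type v} [PartialOrder I] [IsDirectedOrder I] (P : I → Poset U)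
    (hP : IsDirectedPosetSystem P) : Poset U where
  carrier := ⋃ i, (P i).carrier
  le p q := ∃ i, p ∈ (P i).carrier ∧ q ∈ (P i).carrier ∧ (P i).le p q
  refl' p hp := by
    obtain ⟨i, hi⟩ := Set.mem_iUnion.1 hp
    exact ⟨i, hi, hi, (P i).refl' p hi⟩
  trans' p _ q _ r _ := by
    rintro ⟨i, hpi, hqi, h₁⟩ ⟨j, hqj, hrj, h₂⟩
    obtain ⟨k, hik, hjk⟩ := exists_ge_ge i j
    refine ⟨k, hP.mem_mono hik hpi, hP.mem_mono hjk hrj, ?_⟩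
    exact (P k).trans' p (hP.mem_mono hik hpi) q (hP.mem_mono hik hqi) r (hP.mem_mono hjk hrj)
      ((hP.le_iff hik hpi hqi).1 h₁) ((hP.le_iff hjk hqj hrj).1 h₂)

/-! ## The forcing relation

A statement of the forcing language is given by the set of conditions that force it, following the
usual recursive clauses of the forcing relation. The statements needed here quantify only over
ground model sets. -/

/-- A statement of the forcing language, `φ p` meaning that `p` forces `φ`. -/
abbrev Statement (P : Type u) : Type u := P → Prop

/-- A `P`-name for a subset of the ground model set `X`: a set of pairs consisting of (the canonical
name of) an element of `X` and a condition. -/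
abbrev Name (P : Type u) (X : Type) : Type u := Set (X × P)

section Forcing

variable {P : Type u} [Preorder P]

/-- `p ⊩ x ∈ ẏ`: it is dense below `p` to be below some `s` with `(x, s) ∈ ẏ`. -/
def mem {X : Type} (x : X) (y : Name P X) : Statement P :=
  fun p => ∀ q ≤ p, ∃ r ≤ q, ∃ s, (x, s) ∈ y ∧ r ≤ s

/-- A statement about the ground model only. -/
def ground (A : Prop) : Statement P := fun _ => A

/-- `p ⊩ ¬ φ` iff no extension of `p` forces `φ`. -/
def neg (φ : Statement P) : Statement P := fun p => ∀ q ≤ p, ¬ φ q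

/-- `p ⊩ φ → ψ` iff every extension of `p` that forces `φ` forces `ψ`. -/
def imp (φ ψ : Statement P) : Statement P := fun p => ∀ q ≤ p, φ q → ψ q

/-- `p ⊩ ∀ x, φ x` for `x` ranging over a ground model set. -/
def all {X : Type} (φ : X → Statement P) : Statement P := fun p => ∀ x, φ x p

/-- `p ⊩ ∃ x, φ x` for `x` ranging over a ground model set. -/
def ex {X : Type} (φ : X → Statement P) : Statement P := fun p => ∀ q ≤ p, ∃ r ≤ q, ∃ x, φ x r

/-- `⊩ φ`: every condition forces `φ`. -/
def Forced (φ : Statement P) : Prop := ∀ p, φ p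

/-- `h` is a name for a real: the name of a set of pairs of natural numbers which is forced to be (the
graph of) a function from `ω` to `ω`. -/
def IsRealName (h : Name P (ℕ × ℕ)) : Prop :=
  Forced (all fun m : ℕ => ex fun n : ℕ => mem (m, n) h) ∧
  Forced (all fun m : ℕ => all fun n : ℕ => all fun n' : ℕ =>
    imp (mem (m, n) h) (imp (mem (m, n') h) (ground (n = n'))))

/-- The statement `ḣ ↾ k = t`. -/
def restrictEq (h : Name P (ℕ × ℕ)) (k : ℕ) (t : Fin k → ℕ) : Statement P :=
  all fun j : Fin k => mem ((j : ℕ), t j) h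

end Forcing

/-! ## The relation `⊏` and goodness -/

/-- An increasing sequence of closed relations `⊏ₙ` on the Baire space `ℕ → ℕ` such that
`{f | f ⊏ₙ g}` is nowhere dense for all `n` and `g`. -/
structure RelSystem where
  rel : ℕ → (ℕ → ℕ) → (ℕ → ℕ) → Prop
  increasing : ∀ n f g, rel n f g → rel (n + 1) f g
  closed : ∀ n, IsClosed {x : (ℕ → ℕ) × (ℕ → ℕ) | rel n x.1 x.2}
  nowhereDense : ∀ n g, IsNowhereDense {f : ℕ → ℕ | rel n f g}

/-- `f ⊏ g`, i.e. `f ⊏ₙ g` for some `n`. -/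
def RelSystem.Below (S : RelSystem) (f g : ℕ → ℕ) : Prop := ∃ n, S.rel n f g

/-- `f` is `⊏`-unbounded over `Y`. -/
def RelSystem.UnboundedOver (S : RelSystem) (f : ℕ → ℕ) (Y : Set (ℕ → ℕ)) : Prop :=
  ∀ g ∈ Y, ¬ S.Below f g

/-- Level `k` of the tree of the closed relation `⊏ₙ`: the pairs `(x ↾ k, y ↾ k)` with `x ⊏ₙ y`. As
`⊏ₙ` is closed, `f ⊏ₙ g` iff `(f ↾ k, g ↾ k)` is in the tree for all `k`. -/
def RelSystem.tree (S : RelSystem) (n k : ℕ) : Set ((Fin k → ℕ) × (Fin k → ℕ)) :=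
  {st | ∃ x y : ℕ → ℕ, S.rel n x y ∧ (∀ j : Fin k, x j = st.1 j) ∧ ∀ j : Fin k, y j = st.2 j}

/-- The statement `f ⊏ₙ ḣ` of the forcing language, for a ground model real `f` and a name `h` for a
real. In the generic extension `⊏ₙ` denotes the closed relation with the same tree (code), so the
statement says that `(f ↾ k, ḣ ↾ k)` is in the tree of `⊏ₙ` for all `k`. -/
def RelSystem.relName (S : RelSystem) {P : Type u} [Preorder P] (n : ℕ) (f : ℕ → ℕ)
    (h : Name P (ℕ × ℕ)) : Statement P :=
  all fun k : ℕ => all fun t : Fin k → ℕ =>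
    imp (restrictEq h k t) (ground ((fun j : Fin k => f j, t) ∈ S.tree n k))

/-- The statement `f ⊏ ḣ`, i.e. `∃ n, f ⊏ₙ ḣ`. -/
def RelSystem.belowName (S : RelSystem) {P : Type u} [Preorder P] (f : ℕ → ℕ)
    (h : Name P (ℕ × ℕ)) : Statement P :=
  ex fun n : ℕ => S.relName n f h

/-- `P` is `θ`-`⊏`-good. -/
def IsGood (S : RelSystem) (θ : Cardinal.{v}) (P : Type u) [Preorder P] : Prop :=
  ∀ h : Name P (ℕ × ℕ), IsRealName h →
    ∃ Y : Set (ℕ → ℕ), Y.Nonempty ∧ Cardinal.lift.{v} (Cardinal.mk Y) < θ ∧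
      ∀ f : ℕ → ℕ, S.UnboundedOver f Y → Forced (neg (S.belowName f h))

end GoodForcing

namespace GoodForcing

/-! Each name `h` for a real over the limit is approximated, for each `i`, by a `P i`-name `h' i`:
whenever `s` in `P i` forces an initial segment of `h' i`, some extension of `s` in the limit forces
the same segment of `h`. Goodness of `P i` for `h' i` gives `Y i`, and `⋃ i, Y i` works for `h`, its
size being below `θ` by regularity. Indeed, if some condition forces `f ⊏ h`, an extension `r` fixes
`n` with `f ⊏ₙ h`, and `r` lies in some `P i`. As `⊏ₙ` is coded by a tree of initial segments, `r`
then forces `f ⊏ₙ h' i` in `P i`, against the choice of `Y i`.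

The approximation comes from refining maximal antichains of `P i`, each element being a reduction of
a limit condition, its label; labels at level `k` decide `h ↾ k`, and the generic branch reads off
`h' i`. -/

theorem mem.mono {R : Type u} [Preorder R] {X : Type} {x : X} {y : Name R X} {p q : R}
    (hp : mem x y p) (hqp : q ≤ p) : mem x y q :=
  fun r hr => hp r (hr.trans hqp)

/-- A maximal antichain inside a family of conditions: every member of the family is compatible with
a member of the antichain. -/
theorem exists_maximal_antichain_subset {Q : Type*} [Preorder Q] {α : Type*} (D : Set α)
    (c : α → Q) :
    ∃ A ⊆ D, (∀ x ∈ A, ∀ y ∈ A, (∃ u, u ≤ c x ∧ u ≤ c y) → x = y) ∧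
      ∀ d ∈ D, ∃ a ∈ A, ∃ u, u ≤ c d ∧ u ≤ c a := by
  obtain ⟨A, hA⟩ := zorn_subset
    {A : Set α | A ⊆ D ∧ ∀ x ∈ A, ∀ y ∈ A, (∃ u, u ≤ c x ∧ u ≤ c y) → x = y} (by
      intro C hC hchain
      refine ⟨⋃₀ C, ⟨Set.sUnion_subset fun s hs => (hC hs).1, ?_⟩,
        fun s hs => Set.subset_sUnion_of_mem hs⟩
      rintro x ⟨s, hs, hxs⟩ y ⟨t, ht, hyt⟩ hxy
      rcases hchain.total hs ht with hst | hts
      · exact (hC ht).2 x (hst hxs) y hyt hxy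
      · exact (hC hs).2 x hxs y (hts hyt) hxy)
  refine ⟨A, hA.prop.1, hA.prop.2, fun d hd => ?_⟩
  by_contra! hcon
  have hins : insert d A ⊆ A := by
    refine hA.le_of_ge ⟨Set.insert_subset hd hA.prop.1, ?_⟩ (Set.subset_insert d A)
    rintro x (rfl | hx) y (rfl | hy) ⟨u, hux, huy⟩
    · rfl
    · exact absurd huy (hcon y hy u hux)
    · exact absurd hux (hcon x hx u huy)
    · exact hA.prop.2 x hx y hy ⟨u, hux, huy⟩
  have hdA : d ∈ A := hins (Set.mem_insert d A)
  exact hcon d hdA (c d) le_rfl le_rfl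

section CompleteEmbedding

variable {Q R : Type*} [Preorder Q] [Preorder R]

/-- `r` is a reduction of `q` along `e`: every extension of `r` is compatible with `q`. -/
def IsReduction (e : Q → R) (r : Q) (q : R) : Prop :=
  ∀ s ≤ r, ∃ u, u ≤ e s ∧ u ≤ q

/-- A complete embedding of preorders, in terms of reductions. -/
structure IsCompleteEmbedding (e : Q → R) : Prop where
  monotone : Monotone e
  compatible : ∀ a b, (∃ u, u ≤ e a ∧ u ≤ e b) → ∃ c, c ≤ a ∧ c ≤ b
  exists_reduction : ∀ q, ∃ r, IsReduction e r q

/-- A maximal antichain of conditions of the domain, each labelled with a condition of the codomain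
of which it is a reduction. -/
structure IsReductionAntichain (e : Q → R) (A : Set (Q × R)) : Prop where
  reduction : ∀ x ∈ A, IsReduction e x.1 x.2
  eq_of_compatible : ∀ x ∈ A, ∀ y ∈ A, (∃ u, u ≤ x.1 ∧ u ≤ y.1) → x = y
  predense : ∀ s, ∃ a ∈ A, ∃ u, u ≤ s ∧ u ≤ a.1

theorem exists_isReductionAntichain {e : Q → R} (D : Set (Q × R))
    (hD : ∀ x ∈ D, IsReduction e x.1 x.2) (hdense : ∀ s, ∃ x ∈ D, x.1 ≤ s) :
    ∃ A ⊆ D, IsReductionAntichain e A := by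
  obtain ⟨A, hAD, hanti, hmax⟩ := exists_maximal_antichain_subset D Prod.fst
  refine ⟨A, hAD, fun x hx => hD x (hAD hx), hanti, fun s => ?_⟩
  obtain ⟨x, hxD, hxs⟩ := hdense s
  obtain ⟨a, ha, u, hux, hua⟩ := hmax x hxD
  exact ⟨a, ha, u, hux.trans hxs, hua⟩

/-- Below any `s` there is a reduction of any condition below `e s`. -/
theorem IsCompleteEmbedding.exists_reduction_le {e : Q → R} (he : IsCompleteEmbedding e) {s : Q}
    {q : R} (hq : q ≤ e s) : ∃ r ≤ s, IsReduction e r q := by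
  obtain ⟨r, hr⟩ := he.exists_reduction q
  obtain ⟨u, hur, huq⟩ := hr r le_rfl
  obtain ⟨c, hcr, hcs⟩ := he.compatible r s ⟨u, hur, huq.trans hq⟩
  exact ⟨c, hcs, fun t ht => hr t (ht.trans hcr)⟩

/-- A reduction antichain can be refined to one whose labels decide the value of a name for a real
at `k`. -/
theorem IsReductionAntichain.exists_refinement {e : Q → R} (he : IsCompleteEmbedding e)
    {h : Name R (ℕ × ℕ)} (hh : IsRealName h) (k : ℕ) {A : Set (Q × R)}
    (hA : IsReductionAntichain e A) :
    ∃ B, IsReductionAntichain e B ∧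
      ∀ x ∈ B, (∃ y ∈ A, x.1 ≤ y.1 ∧ x.2 ≤ y.2) ∧ ∃ m, mem (k, m) h x.2 := by
  obtain ⟨B, hBD, hB⟩ := exists_isReductionAntichain (e := e)
    {x : Q × R | IsReduction e x.1 x.2 ∧ (∃ y ∈ A, x.1 ≤ y.1 ∧ x.2 ≤ y.2) ∧
      ∃ m, mem (k, m) h x.2} (fun x hx => hx.1) (by
      intro s
      -- Go up from `r` to a condition below the label of `y`, decide `h` at `k` there, then reduce
      -- back below `r`.
      obtain ⟨y, hy, r, hrs, hry⟩ := hA.predense s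
      obtain ⟨u, hur, huy⟩ := hA.reduction y hy r hry
      obtain ⟨q, hqu, m, hm⟩ := hh.1 u k u le_rfl
      obtain ⟨r', hr', hred⟩ := he.exists_reduction_le (hqu.trans hur)
      exact ⟨(r', q), ⟨hred, ⟨y, hy, hr'.trans hry, hqu.trans huy⟩, m, hm⟩, hr'.trans hrs⟩)
  exact ⟨B, hB, fun x hx => (hBD hx).2⟩

/-- Refinement of the labels as well as of the antichains lets a single label at level `k` carry all
decisions made at earlier levels. -/
theorem IsCompleteEmbedding.exists_refining_sequence {e : Q → R} (he : IsCompleteEmbedding e)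
    {h : Name R (ℕ × ℕ)} (hh : IsRealName h) :
    ∃ A : ℕ → Set (Q × R), (∀ k, IsReductionAntichain e (A k)) ∧
      ∀ k, ∀ x ∈ A (k + 1), (∃ y ∈ A k, x.1 ≤ y.1 ∧ x.2 ≤ y.2) ∧ ∃ m, mem (k, m) h x.2 := by
  obtain ⟨A₀, -, hA₀⟩ := exists_isReductionAntichain (e := e)
    {x : Q × R | IsReduction e x.1 x.2} (fun x hx => hx) (by
      intro s
      obtain ⟨r, hrs, hr⟩ := he.exists_reduction_le (le_refl (e s))
      exact ⟨(r, e s), hr, hrs⟩)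
  choose next hnext using fun (k : ℕ) (A : {A : Set (Q × R) // IsReductionAntichain e A}) =>
    A.2.exists_refinement he hh k
  let seq : ℕ → {A : Set (Q × R) // IsReductionAntichain e A} := fun n =>
    Nat.rec ⟨A₀, hA₀⟩ (fun k A => ⟨next k A, (hnext k A).1⟩) n
  exact ⟨fun k => (seq k).1, fun k => (seq k).2, fun k => (hnext k (seq k)).2⟩

/-- Along a complete embedding, every name `h` for a real is approximated by a name `h'` for a real
over the domain: no condition of the domain rules out, in the codomain, an initial segment which it
forces for `h'`. -/
theorem IsCompleteEmbedding.exists_approximating_name {e : Q → R} (he : IsCompleteEmbedding e)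
    {h : Name R (ℕ × ℕ)} (hh : IsRealName h) :
    ∃ h' : Name Q (ℕ × ℕ), IsRealName h' ∧
      ∀ (k : ℕ) (t : Fin k → ℕ) (s : Q), restrictEq h' k t s → ∃ u ≤ e s, restrictEq h k t u := by
  obtain ⟨A, hA, href⟩ := he.exists_refining_sequence hh
  -- The value at `m` is read at level `m + 1`, so level `k` determines exactly the first `k`
  -- values.
  refine ⟨{z | ∃ q, (z.2, q) ∈ A (z.1.1 + 1) ∧ mem z.1 h q}, ⟨?_, ?_⟩, ?_⟩
  · intro p m q _
    obtain ⟨a, ha, u, huq, hua⟩ := (hA (m + 1)).predense q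
    obtain ⟨n, hn⟩ := (href m a ha).2
    exact ⟨u, huq, n, fun v hv => ⟨v, le_rfl, a.1, ⟨a.2, ha, hn⟩, hv.trans hua⟩⟩
  · intro p m n n' s _ hs s' hs' hs''
    obtain ⟨v, hv, a, ⟨q, hq, hmem⟩, hva⟩ := hs s' hs'
    obtain ⟨w, hw, b, ⟨q', hq', hmem'⟩, hwb⟩ := hs'' v hv
    have hab := (hA (m + 1)).eq_of_compatible _ hq _ hq' ⟨w, hw.trans hva, hwb⟩
    obtain rfl : q = q' := congrArg Prod.snd hab
    exact hh.2 q m n n' q le_rfl hmem q le_rfl hmem'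
  · intro k t s hs
    have hanc : ∀ k, ∀ j ≤ k, ∀ x ∈ A k, ∃ y ∈ A j, x.1 ≤ y.1 ∧ x.2 ≤ y.2 := by
      intro k j hjk
      induction k, hjk using Nat.le_induction with
      | base => exact fun x hx => ⟨x, hx, le_rfl, le_rfl⟩
      | succ k _ ih =>
        intro x hx
        obtain ⟨y, hy, hxy₁, hxy₂⟩ := (href k x hx).1
        obtain ⟨z, hz, hyz₁, hyz₂⟩ := ih y hy
        exact ⟨z, hz, hxy₁.trans hyz₁, hxy₂.trans hyz₂⟩
    obtain ⟨a, ha, s', hs's, hs'a⟩ := (hA k).predense s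
    obtain ⟨u, hus', hua⟩ := (hA k).reduction a ha s' hs'a
    refine ⟨u, hus'.trans (he.monotone hs's), fun j => ?_⟩
    obtain ⟨v, hv, b, ⟨q, hq, hmem⟩, hvb⟩ := hs j s' hs's
    -- The ancestor of `a` at level `j + 1` is compatible with the element giving the value at `j`,
    -- so they coincide and the label of `a` forces that value.
    obtain ⟨c, hc, hac₁, hac₂⟩ := hanc k (j + 1) j.2 a ha
    obtain rfl : c = (b, q) := (hA (j + 1)).eq_of_compatible _ hc _ hq
      ⟨v, (hv.trans hs'a).trans hac₁, hvb⟩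
    exact hmem.mono (hua.trans hac₂)

/-- If `p` forces `¬ f ⊏ h'` for an approximation `h'` of `h`, then `e p` does not force
`f ⊏ₙ h`. -/
theorem not_relName_of_neg_belowName (S : RelSystem) {e : Q → R} (he : Monotone e)
    {h : Name R (ℕ × ℕ)} {h' : Name Q (ℕ × ℕ)}
    (happrox : ∀ (k : ℕ) (t : Fin k → ℕ) (s : Q), restrictEq h' k t s →
      ∃ u ≤ e s, restrictEq h k t u)
    {f : ℕ → ℕ} {p : Q} (hp : neg (S.belowName f h') p) (n : ℕ) : ¬ S.relName n f h (e p) := by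
  intro hrel
  have hrel' : S.relName n f h' p := by
    intro k t s hsp hs
    obtain ⟨u, hus, hu⟩ := happrox k t s hs
    exact hrel k t u (hus.trans (he hsp)) hu
  exact hp p le_rfl fun q hq =>
    ⟨q, le_rfl, n, fun k t s hs => hrel' k t s (hs.trans hq)⟩

end CompleteEmbedding

/-- Conditions of the larger forcing notion have reductions to a complete suborder. -/
theorem Poset.IsCompleteSuborder.exists_reduction {U : Type u} {P Q : Poset U}
    (hPQ : P.IsCompleteSuborder Q) {q : U} (hq : q ∈ Q.carrier) :
    ∃ r ∈ P.carrier, ∀ s ∈ P.carrier, P.le s r → Q.Compatible s q := by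
  by_contra! hcon
  -- Without a reduction of `q`, the conditions of `P` incompatible with `q` are dense in `P`. A
  -- maximal antichain among them is maximal in `P`, hence in `Q`, yet no member is compatible with
  -- `q`.
  obtain ⟨A, hAD, hanti, hmax⟩ := exists_maximal_antichain_subset
    {x : P.Cond | ¬ Q.Compatible x.1 q} id
  have hA : P.IsMaxAntichain (Subtype.val '' A) := by
    refine ⟨?_, ?_, ?_⟩
    · rintro _ ⟨x, -, rfl⟩
      exact x.2
    · rintro _ ⟨x, hx, rfl⟩ _ ⟨y, hy, rfl⟩ hxy ⟨u, hu, hux, huy⟩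
      exact hxy (congrArg Subtype.val (hanti x hx y hy ⟨⟨u, hu⟩, hux, huy⟩))
    · intro p hp
      obtain ⟨s, hs, hsp, hsq⟩ := hcon p hp
      obtain ⟨a, ha, u, hus, hua⟩ := hmax ⟨s, hs⟩ hsq
      exact ⟨a.1, ⟨a, ha, rfl⟩, u.1, u.2, P.trans' u.1 u.2 s hs p hp hus hsp, hua⟩
  obtain ⟨_, ⟨a, ha, rfl⟩, r, hr, hrq, hra⟩ := (hPQ.2.2.2 _ hA).2.2 q hq
  exact hAD ha ⟨r, hr, hra, hrq⟩

section DirectLimit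

variable {U : Type u} {I : Type v} [PartialOrder I] [IsDirectedOrder I] {P : I → Poset U}

/-- The inclusion of a member of a directed system in the direct limit. -/
def toDirectLimit (hP : IsDirectedPosetSystem P) (i : I) (p : (P i).Cond) :
    (directLimit P hP).Cond :=
  ⟨p.1, Set.mem_iUnion.2 ⟨i, p.2⟩⟩

/-- By directedness the finitely many conditions involved lie in one `P k` with `i ≤ k`, where
completeness of `P i` in `P k` applies. -/
theorem isCompleteEmbedding_toDirectLimit (hP : IsDirectedPosetSystem P) (i : I) :
    IsCompleteEmbedding (toDirectLimit hP i) where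
  monotone p q hpq := ⟨i, p.2, q.2, hpq⟩
  compatible := by
    rintro a b ⟨u, ⟨j, huj, haj, hua⟩, ⟨l, hul, hbl, hub⟩⟩
    obtain ⟨m, hjm, hlm⟩ := exists_ge_ge j l
    obtain ⟨k, hmk, hik⟩ := exists_ge_ge m i
    have hcompat : (P k).Compatible a.1 b.1 :=
      ⟨u.1, hP.mem_mono (hjm.trans hmk) huj, (hP.le_iff (hjm.trans hmk) huj haj).1 hua,
        (hP.le_iff (hlm.trans hmk) hul hbl).1 hub⟩
    rcases hik.eq_or_lt with rfl | hlt
    · obtain ⟨c, hc, hca, hcb⟩ := hcompat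
      exact ⟨⟨c, hc⟩, hca, hcb⟩
    · obtain ⟨c, hc, hca, hcb⟩ := (hP i k hlt).2.2.1 a.1 a.2 b.1 b.2 hcompat
      exact ⟨⟨c, hc⟩, hca, hcb⟩
  exists_reduction q := by
    obtain ⟨j, hqj⟩ := Set.mem_iUnion.1 q.2
    obtain ⟨k, hik, hjk⟩ := exists_ge_ge i j
    have hqk := hP.mem_mono hjk hqj
    rcases hik.eq_or_lt with rfl | hlt
    · exact ⟨⟨q.1, hqk⟩, fun s hs =>
        ⟨toDirectLimit hP i s, le_rfl, ⟨i, s.2, hqk, hs⟩⟩⟩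
    · obtain ⟨r, hr, hred⟩ := (hP i k hlt).exists_reduction hqk
      refine ⟨⟨r, hr⟩, fun s hs => ?_⟩
      obtain ⟨u, hu, hus, huq⟩ := hred s.1 s.2 hs
      exact ⟨toDirectLimit hP k ⟨u, hu⟩, ⟨k, hu, hP.mem_mono hik s.2, hus⟩, ⟨k, hu, hqk, huq⟩⟩

end DirectLimit

end GoodForcing

theorem theorem3p10 {U : Type u} {I : Type v} [PartialOrder I] [IsDirectedOrder I]
    (S : GoodForcing.RelSystem) (θ : Cardinal.{v}) (hθ : θ.IsRegular)
    (hθ_unc : Cardinal.aleph0 < θ) (hI : Cardinal.mk I < θ)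
    (P : I → GoodForcing.Poset U) (hP : GoodForcing.IsDirectedPosetSystem P)
    (hgood : ∀ i, GoodForcing.IsGood S θ (P i).Cond) :
    GoodForcing.IsGood S θ (GoodForcing.directLimit P hP).Cond := by
  intro h hh
  choose h' hh' happrox using fun i =>
    (GoodForcing.isCompleteEmbedding_toDirectLimit hP i).exists_approximating_name hh
  choose Y hYne hYcard hY using fun i => hgood i (h' i) (hh' i)
  have hcard : Cardinal.lift.{v} (Cardinal.mk (⋃ i, Y i)) < θ := by
    have hsum : Cardinal.sum (fun i => Cardinal.lift.{v} (Cardinal.mk (Y i))) < θ :=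
      Cardinal.sum_lt_of_isRegular hθ hI hYcard
    rw [← Cardinal.lift_sum, Cardinal.lift_id] at hsum
    exact Cardinal.mk_iUnion_le_sum_mk_lift.trans_lt hsum
  rcases isEmpty_or_nonempty I with hempty | hne
  -- With no indices the limit has no conditions, so any small nonempty set serves.
  · refine ⟨{0}, Set.singleton_nonempty 0, ?_, fun f _ p => ?_⟩
    · rw [Cardinal.mk_singleton, Cardinal.lift_one]
      exact Cardinal.one_lt_aleph0.trans hθ_unc
    · obtain ⟨i, -⟩ := Set.mem_iUnion.1 p.2
      exact hempty.elim i
  · refine ⟨⋃ i, Y i, Set.nonempty_iUnion.2 ⟨hne.some, hYne _⟩, hcard, fun f hf p q _ hq => ?_⟩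
    obtain ⟨r, -, n, hr⟩ := hq q le_rfl
    obtain ⟨i, hi⟩ := Set.mem_iUnion.1 r.2
    exact GoodForcing.not_relName_of_neg_belowName S
      (GoodForcing.isCompleteEmbedding_toDirectLimit hP i).monotone (happrox i)
      (hY i f (fun g hg => hf g (Set.mem_iUnion.2 ⟨i, hg⟩)) ⟨r.1, hi⟩) n hr
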